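/- Let $n$ be a natural number and let $A, B, C$ be real symmetric $n\times n$ matrices of trace zero. Then $$\left(\|A\|^2+\|B\|^2+\|C\|^2\right)^2 \;\ge\; 2\|[A,B]\|^2+2\|[B,C]\|^2+2\|[C,A]\|^2,$$ where $[X,Y]=XY-YX$ is the commutator and $\|X\|=\bigl(\sum_{i,j=1}^n x_{ij}^2\bigr)^{1/2}$ is the Frobenius norm. -/

import Mathlib

/- The norm on matrices is the Frobenius norm `‖A‖ = (∑ i, ∑ j, ‖A i j‖ ^ 2) ^ (1 / 2)`,
and `⁅A, B⁆` is the commutator `A * B - B * A`. -/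
attribute [local instance] Matrix.frobeniusNormedAddCommGroup

/-- The norm in force on real square matrices is the Frobenius norm. -/
theorem frobenius_norm_sq_eq {n : ℕ} (A : Matrix (Fin n) (Fin n) ℝ) :
    ‖A‖ ^ 2 = ∑ i, ∑ j, A i j ^ 2 := by
  have h : 0 ≤ ∑ i, ∑ j, A i j ^ 2 :=
    Finset.sum_nonneg fun i _ => Finset.sum_nonneg fun j _ => sq_nonneg _
  rw [Matrix.frobenius_norm_def]
  simp only [Real.norm_eq_abs, Real.rpow_two, sq_abs]
  rw [← Real.sqrt_eq_rpow, Real.sq_sqrt h]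

/-!
The inequality holds for any finite family of real symmetric matrices `S a`, in the form
`∑ a b, ‖[S a, S b]‖² ≤ (∑ a, ‖S a‖²)²`, where the sum over ordered pairs accounts for the factor
`2`; this is `sum_sum_frobInner_lie_le`.

Let `M` be the largest value of the left side on families with `∑ a, ‖S a‖² = 1`. It is attained by
compactness, and homogeneity reduces the claim to `M ≤ 1`. At a maximizing family choose a unit
vector `c` for which `X = ∑ a, c a • S a` has the largest norm. Two estimates of
`K = ∑ a, ‖[X, S a]‖²` then meet:

* Moving the family in the direction `a ↦ c a • X`, the vanishing first variation gives
  `M * ‖X‖² = K`; only `≤` is needed (`mul_frobInner_le_of_maximizer`).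
* `K ≤ ‖X‖² * ∑ a, ‖S a‖² = ‖X‖²` (`sum_frobInner_lie_le`). After an orthogonal change of basis
  `X` is diagonal with entries `d i`, and `K = ∑ i j, (d i - d j)² r i j` with
  `r i j = ∑ a, (S a i j)²`, a Laplacian quadratic form. The choice of `c` bounds each off-diagonal
  weight by `‖X‖² / 2`, while the diagonal weights add up to at least `‖X‖²`, which pays for the
  contribution of the largest weight in the bound below.

The Laplacian bound (`sum_sq_sub_mul_weight_le`) says that a weighted graph Laplacian has norm at
most the sum of all weights plus the largest one. The pairs with `(d i - d j)² > ∑ i, (d i)²`,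
whose terms exceed their share of the weight sum, all share a vertex, and the star with `m` edges
has largest Laplacian eigenvalue `m + 1`.
-/

/-! ### A bound for weighted graph Laplacians -/

/-- The positive parts of `(η i - η j) ^ 2 - τ` are supported on a star: if `∑ i, η i ^ 2 ≤ τ`, all
pairs at squared distance more than `τ` share a vertex. Two disjoint such pairs would have total
squared distance at most `2 τ`, and a triangle of such pairs at most `3 τ`. -/
theorem exists_common_vertex_of_far_pairs {n : Type*} [Fintype n] [Nonempty n]
    (η : n → ℝ) (τ : ℝ) (hη : ∑ i, η i ^ 2 ≤ τ) :
    ∃ k, ∀ i j, τ < (η i - η j) ^ 2 → i = k ∨ j = k := by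
  classical
  by_cases hbig : ∃ p q, τ < (η p - η q) ^ 2
  swap
  · push Not at hbig
    exact ⟨Classical.arbitrary n, fun i j h => absurd h (hbig i j).not_gt⟩
  have hτ : 0 ≤ τ := (Finset.sum_nonneg fun i _ => sq_nonneg (η i)).trans hη
  have hne : ∀ {i j}, τ < (η i - η j) ^ 2 → i ≠ j := by
    rintro i j h rfl
    simp at h
    linarith
  have hsub : ∀ s : Finset n, ∑ i ∈ s, η i ^ 2 ≤ τ := fun s =>
    (Finset.sum_le_sum_of_subset_of_nonneg (Finset.subset_univ s)
      fun i _ _ => sq_nonneg _).trans hη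
  have hdisj : ∀ {a b c d}, τ < (η a - η b) ^ 2 → τ < (η c - η d) ^ 2 →
      a = c ∨ a = d ∨ b = c ∨ b = d := by
    intro a b c d hab hcd
    by_contra! h
    obtain ⟨h1, h2, h3, h4⟩ := h
    have := hsub {a, b, c, d}
    rw [Finset.sum_insert (by simp [hne hab, h1, h2]), Finset.sum_insert (by simp [h3, h4]),
      Finset.sum_insert (by simp [hne hcd]), Finset.sum_singleton] at this
    nlinarith [sq_nonneg (η a + η b), sq_nonneg (η c + η d)]
  have htri : ∀ {a b c}, τ < (η a - η b) ^ 2 → τ < (η b - η c) ^ 2 → τ < (η c - η a) ^ 2 →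
      False := by
    intro a b c hab hbc hca
    have := hsub {a, b, c}
    rw [Finset.sum_insert (by simp [hne hab, (hne hca).symm]),
      Finset.sum_insert (by simp [hne hbc]), Finset.sum_singleton] at this
    nlinarith [sq_nonneg (η a + η b + η c)]
  have hsymm : ∀ {i j}, τ < (η i - η j) ^ 2 → τ < (η j - η i) ^ 2 := by
    intro i j h
    rwa [sub_sq_comm]
  obtain ⟨p, q, hpq⟩ := hbig
  by_contra! h
  -- `hij` is a far pair avoiding `p`, and `hkl` one avoiding `q`.
  obtain ⟨i, j, hij, hip, hjp⟩ := h p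
  obtain ⟨k, l, hkl, hkq, hlq⟩ := h q
  have hp : ∃ j, j ≠ p ∧ τ < (η q - η j) ^ 2 := by
    rcases hdisj hpq hij with h | h | h | h
    · exact absurd h.symm hip
    · exact absurd h.symm hjp
    · exact ⟨j, hjp, h ▸ hij⟩
    · exact ⟨i, hip, h ▸ hsymm hij⟩
  have hq : ∃ l, l ≠ q ∧ τ < (η p - η l) ^ 2 := by
    rcases hdisj hpq hkl with h | h | h | h
    · exact ⟨l, hlq, h ▸ hkl⟩
    · exact ⟨k, hkq, h ▸ hsymm hkl⟩
    · exact absurd h.symm hkq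
    · exact absurd h.symm hlq
  obtain ⟨j, hjp, hqj⟩ := hp
  obtain ⟨l, hlq, hpl⟩ := hq
  rcases hdisj hqj hpl with h | h | h | h
  · exact hne hpq h.symm
  · exact hlq h.symm
  · exact hjp h
  · subst h
    exact htri hpq hqj (hsymm hpl)

/-- The largest eigenvalue of the Laplacian of a star with `m` edges is `m + 1`. Here the edges are
the `j` with `τ < (η k - η j) ^ 2`. -/
theorem sum_posPart_star_le {n : Type*} [Fintype n] (η : n → ℝ) (τ : ℝ)
    (hη : ∑ i, η i ^ 2 ≤ τ) (k : n) :
    ∑ j, max ((η k - η j) ^ 2 - τ) 0 ≤ τ := by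
  classical
  have hτ : 0 ≤ τ := (Finset.sum_nonneg fun i _ => sq_nonneg (η i)).trans hη
  set J : Finset n := {j | τ < (η k - η j) ^ 2} with hJ
  have hk : k ∉ J := by simp [hJ, hτ]
  have hsum : ∑ j, max ((η k - η j) ^ 2 - τ) 0 = ∑ j ∈ J, ((η k - η j) ^ 2 - τ) := by
    rw [hJ, Finset.sum_filter]
    refine Finset.sum_congr rfl fun j _ => ?_
    split_ifs with h
    · exact max_eq_left (by linarith)
    · exact max_eq_right (by linarith)
  have hle : η k ^ 2 + ∑ j ∈ J, η j ^ 2 ≤ τ := by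
    rw [← Finset.sum_insert (f := fun i => η i ^ 2) hk]
    exact (Finset.sum_le_sum_of_subset_of_nonneg (Finset.subset_univ _)
      fun i _ _ => sq_nonneg _).trans hη
  have hexp : ∑ j ∈ J, ((η k - η j) ^ 2 - τ)
      = (J.card : ℝ) * η k ^ 2 - 2 * η k * ∑ j ∈ J, η j + ∑ j ∈ J, η j ^ 2 - J.card * τ := by
    simp only [sub_sq, Finset.sum_sub_distrib, Finset.sum_add_distrib, Finset.sum_const,
      nsmul_eq_mul, Finset.mul_sum]
  have hcs : (∑ j ∈ J, η j) ^ 2 ≤ J.card * ∑ j ∈ J, η j ^ 2 := sq_sum_le_card_mul_sum_sq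
  rw [hsum, hexp]
  have hcard : (0 : ℝ) ≤ J.card := Nat.cast_nonneg _
  nlinarith [sq_nonneg (η k + ∑ j ∈ J, η j), mul_le_mul_of_nonneg_left hle hcard]

/-- A graph Laplacian with nonnegative edge weights `r` has its eigenvalues bounded by the total
weight plus the largest weight. The sums run over ordered pairs, so each edge counts twice. Diagonal
weights are loops, which cancel from both sides, so `R` need not bound them. -/
theorem sum_sq_sub_mul_weight_le {n : Type*} [Fintype n] (η : n → ℝ) (τ : ℝ)
    (hη : ∑ i, η i ^ 2 ≤ τ) (r : n → n → ℝ) (hr : ∀ i j, 0 ≤ r i j) (R : ℝ)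
    (hrR : ∀ i j, i ≠ j → r i j ≤ R) (hR : 0 ≤ R) :
    ∑ i, ∑ j, (η i - η j) ^ 2 * r i j + τ * ∑ i, r i i
      ≤ τ * ∑ i, ∑ j, r i j + 2 * τ * R := by
  classical
  rcases isEmpty_or_nonempty n with hn | hn
  · simp only [Finset.univ_eq_empty, Finset.sum_empty] at hη ⊢
    nlinarith [mul_nonneg hη hR]
  have hτ : 0 ≤ τ := (Finset.sum_nonneg fun i _ => sq_nonneg (η i)).trans hη
  obtain ⟨k, hk⟩ := exists_common_vertex_of_far_pairs η τ hη
  set g : n → n → ℝ := fun i j => max ((η i - η j) ^ 2 - τ) 0 with hg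
  have hg0 : ∀ i j, 0 ≤ g i j := fun i j => le_max_right _ _
  have hstar : ∑ j, g k j ≤ τ := sum_posPart_star_le η τ hη k
  have hgcomm : ∀ i j, g i j = g j i := fun i j => by simp only [hg, sub_sq_comm (η i)]
  have hgsum : ∑ i, ∑ j, g i j ≤ 2 * τ := by
    have hpt : ∀ i j, g i j ≤ (if i = k then g k j else 0) + (if j = k then g k i else 0) := by
      intro i j
      have h1 : 0 ≤ if i = k then g k j else 0 := by split_ifs <;> simp [hg0]
      have h2 : 0 ≤ if j = k then g k i else 0 := by split_ifs <;> simp [hg0]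
      by_cases hij : τ < (η i - η j) ^ 2
      · rcases hk i j hij with rfl | rfl
        · simpa using h2
        · rw [if_pos rfl, hgcomm]
          linarith
      · have : g i j = 0 := max_eq_right (by linarith)
        linarith
    calc ∑ i, ∑ j, g i j
        ≤ ∑ i, ∑ j, ((if i = k then g k j else 0) + (if j = k then g k i else 0)) :=
          Finset.sum_le_sum fun i _ => Finset.sum_le_sum fun j _ => hpt i j
      _ = ∑ j, g k j + ∑ j, g k j := by
          simp only [Finset.sum_add_distrib]
          congr 1
          · rw [Finset.sum_comm]
            simp
          · simp
      _ ≤ 2 * τ := by linarith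
  have hpt : ∀ i j, (η i - η j) ^ 2 * r i j + τ * (if i = j then r i j else 0)
      ≤ τ * r i j + g i j * R := by
    intro i j
    by_cases hij : i = j
    · subst hij
      have := mul_nonneg (hg0 i i) hR
      simpa using this
    · rw [if_neg hij]
      have h1 : (η i - η j) ^ 2 - τ ≤ g i j := le_max_left _ _
      have h2 := mul_le_mul_of_nonneg_right h1 (hr i j)
      have h3 := mul_le_mul_of_nonneg_left (hrR i j hij) (hg0 i j)
      linarith
  have htot := Finset.sum_le_sum fun i (_ : i ∈ Finset.univ) =>
    Finset.sum_le_sum fun j (_ : j ∈ Finset.univ) => hpt i j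
  simp only [Finset.sum_add_distrib, ← Finset.mul_sum, ← Finset.sum_mul, Finset.sum_ite_eq,
    Finset.mem_univ, if_true] at htot
  have := mul_le_mul_of_nonneg_right hgsum hR
  linarith

/-! ### The Frobenius inner product -/

/-- The Frobenius inner product `∑ i j, M i j * P i j` of real matrices. -/
noncomputable def frobInner {n : Type*} [Fintype n] :
    Matrix n n ℝ →ₗ[ℝ] Matrix n n ℝ →ₗ[ℝ] ℝ :=
  LinearMap.mk₂ ℝ (fun M P => (M.transpose * P).trace)
    (fun _ _ _ => by simp [add_mul]) (fun _ _ _ => by simp)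
    (fun _ _ _ => by simp [mul_add]) (fun _ _ _ => by simp)

theorem frobInner_eq_trace {n : Type*} [Fintype n] (M P : Matrix n n ℝ) :
    frobInner M P = (M.transpose * P).trace := rfl

theorem frobInner_eq_sum {n : Type*} [Fintype n] (M P : Matrix n n ℝ) :
    frobInner M P = ∑ i, ∑ j, M i j * P i j := by
  rw [frobInner_eq_trace, Finset.sum_comm]
  simp [Matrix.trace, Matrix.mul_apply]

theorem frobInner_comm {n : Type*} [Fintype n] (M P : Matrix n n ℝ) :
    frobInner M P = frobInner P M := by
  simp only [frobInner_eq_sum, mul_comm]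

theorem frobInner_self_eq_sum {n : Type*} [Fintype n] (M : Matrix n n ℝ) :
    frobInner M M = ∑ i, ∑ j, M i j ^ 2 := by
  simp only [frobInner_eq_sum, sq]

theorem frobInner_self_nonneg {n : Type*} [Fintype n] (M : Matrix n n ℝ) :
    0 ≤ frobInner M M := by
  rw [frobInner_self_eq_sum]
  exact Finset.sum_nonneg fun i _ => Finset.sum_nonneg fun j _ => sq_nonneg _

theorem frobInner_self_conj {n : Type*} [Fintype n] [DecidableEq n] {U : Matrix n n ℝ}
    (hU : U * U.transpose = 1) (M : Matrix n n ℝ) :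
    frobInner (U.transpose * M * U) (U.transpose * M * U) = frobInner M M := by
  simp only [frobInner_eq_trace, Matrix.transpose_mul, Matrix.transpose_transpose]
  calc (U.transpose * (M.transpose * U) * (U.transpose * M * U)).trace
      = (U.transpose * (M.transpose * (U * U.transpose) * M * U)).trace := by
        simp only [mul_assoc]
    _ = (M.transpose * M * (U * U.transpose)).trace := by
        rw [hU, Matrix.trace_mul_comm, mul_one]
        simp only [mul_assoc, hU]
    _ = (M.transpose * M).trace := by rw [hU, mul_one]

/-! ### Commutators with a combination of largest norm -/

/-- The case of `sum_frobInner_lie_le` in which the combination of largest norm is diagonal. -/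
theorem sum_frobInner_lie_diagonal_le {n ι : Type*} [Fintype n] [DecidableEq n] [Fintype ι]
    (S : ι → Matrix n n ℝ) (hS : ∀ a, (S a).IsSymm) (c : ι → ℝ) (hc : ∑ a, c a ^ 2 = 1)
    (d : n → ℝ) (hd : ∑ a, c a • S a = Matrix.diagonal d)
    (hmax : ∀ v : ι → ℝ, frobInner (∑ a, v a • S a) (∑ a, v a • S a)
      ≤ (∑ i, d i ^ 2) * ∑ a, v a ^ 2) :
    ∑ a, frobInner ⁅Matrix.diagonal d, S a⁆ ⁅Matrix.diagonal d, S a⁆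
      ≤ (∑ i, d i ^ 2) * ∑ a, frobInner (S a) (S a) := by
  set T := ∑ i, d i ^ 2 with hT
  have hT0 : 0 ≤ T := Finset.sum_nonneg fun i _ => sq_nonneg _
  set r : n → n → ℝ := fun i j => ∑ a, S a i j ^ 2 with hr
  have hr0 : ∀ i j, 0 ≤ r i j := fun i j => Finset.sum_nonneg fun a _ => sq_nonneg _
  have hK : ∑ a, frobInner ⁅Matrix.diagonal d, S a⁆ ⁅Matrix.diagonal d, S a⁆
      = ∑ i, ∑ j, (d i - d j) ^ 2 * r i j := by
    simp only [frobInner_self_eq_sum, hr, Finset.mul_sum]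
    rw [Finset.sum_comm]
    refine Finset.sum_congr rfl fun i _ => ?_
    rw [Finset.sum_comm]
    refine Finset.sum_congr rfl fun j _ => Finset.sum_congr rfl fun a _ => ?_
    rw [Ring.lie_def, Matrix.sub_apply, Matrix.diagonal_mul, Matrix.mul_diagonal]
    ring
  have hN : ∑ a, frobInner (S a) (S a) = ∑ i, ∑ j, r i j := by
    simp only [frobInner_self_eq_sum, hr]
    rw [Finset.sum_comm]
    exact Finset.sum_congr rfl fun i _ => Finset.sum_comm
  -- The combination with coefficients `S a i j` has `r i j` as its entries `(i, j)` and `(j, i)`.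
  have hrR : ∀ i j, i ≠ j → r i j ≤ T / 2 := by
    intro i j hij
    set P := ∑ a, S a i j • S a with hP
    have hPij : P i j = r i j := by
      simp [hP, hr, Matrix.sum_apply, sq]
    have hPji : P j i = r i j := by
      rw [← hPij]
      simp only [hP, Matrix.sum_apply, Matrix.smul_apply]
      exact Finset.sum_congr rfl fun a _ => by rw [(hS a).apply]
    have h1 : frobInner P P ≤ T * r i j := hmax fun a => S a i j
    have h2 : P i j ^ 2 + P j i ^ 2 ≤ frobInner P P := by
      rw [frobInner_self_eq_sum, ← Fintype.sum_prod_type' fun i j => P i j ^ 2,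
        ← Finset.sum_pair (f := fun x : n × n => P x.1 x.2 ^ 2) (a := (i, j)) (b := (j, i))
          (by simp [hij])]
      exact Finset.sum_le_sum_of_subset_of_nonneg (Finset.subset_univ _)
        fun _ _ _ => sq_nonneg _
    rw [hPij, hPji] at h2
    rcases (hr0 i j).eq_or_lt with h | h
    · rw [← h]
      linarith
    · by_contra! hlt
      nlinarith
  have hdiag : T ≤ ∑ i, r i i := by
    refine Finset.sum_le_sum fun i _ => ?_
    have hdi : d i = ∑ a, c a * S a i i := by
      have := congrFun (congrFun hd i) i
      simpa [Matrix.sum_apply] using this.symm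
    have := Finset.sum_mul_sq_le_sq_mul_sq Finset.univ c fun a => S a i i
    rwa [hc, one_mul, ← hdi] at this
  have hlap := sum_sq_sub_mul_weight_le d T le_rfl r hr0 (T / 2) hrR (by linarith)
  have := mul_le_mul_of_nonneg_left hdiag hT0
  rw [hK, hN]
  linarith

/-- A real symmetric matrix is diagonalized by an orthogonal matrix. -/
theorem exists_orthogonal_conj_eq_diagonal {n : Type*} [Fintype n] [DecidableEq n]
    {X : Matrix n n ℝ} (hX : X.IsSymm) :
    ∃ (U : Matrix n n ℝ) (d : n → ℝ), U * U.transpose = 1 ∧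
      U.transpose * X * U = Matrix.diagonal d := by
  have hH : X.IsHermitian := by
    rw [Matrix.IsHermitian, Matrix.conjTranspose_eq_transpose_of_trivial]
    exact hX
  refine ⟨hH.eigenvectorUnitary, hH.eigenvalues, ?_, ?_⟩
  · have := Unitary.mul_star_self_of_mem hH.eigenvectorUnitary.2
    rwa [Matrix.star_eq_conjTranspose, Matrix.conjTranspose_eq_transpose_of_trivial] at this
  · have := hH.conjStarAlgAut_star_eigenvectorUnitary
    rw [Unitary.conjStarAlgAut_star_apply, Matrix.star_eq_conjTranspose,
      Matrix.conjTranspose_eq_transpose_of_trivial] at this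
    simpa using this

/-- If `∑ a, c a • S a` has the largest norm among the combinations of symmetric matrices `S a` with
unit coefficient vectors, then commuting with it scales the family by at most that norm. -/
theorem sum_frobInner_lie_le {n ι : Type*} [Fintype n] [DecidableEq n] [Fintype ι]
    (S : ι → Matrix n n ℝ) (hS : ∀ a, (S a).IsSymm) (c : ι → ℝ) (hc : ∑ a, c a ^ 2 = 1)
    (X : Matrix n n ℝ) (hX : X = ∑ a, c a • S a)
    (hmax : ∀ v : ι → ℝ, frobInner (∑ a, v a • S a) (∑ a, v a • S a)
      ≤ frobInner X X * ∑ a, v a ^ 2) :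
    ∑ a, frobInner ⁅X, S a⁆ ⁅X, S a⁆ ≤ frobInner X X * ∑ a, frobInner (S a) (S a) := by
  have hXs : X.IsSymm := by
    rw [hX, Matrix.IsSymm, Matrix.transpose_sum]
    exact Finset.sum_congr rfl fun a _ => by rw [Matrix.transpose_smul, (hS a).eq]
  obtain ⟨U, d, hU, hd⟩ := exists_orthogonal_conj_eq_diagonal hXs
  set S' : ι → Matrix n n ℝ := fun a => U.transpose * S a * U with hS'
  have hcomb : ∀ v : ι → ℝ, ∑ a, v a • S' a = U.transpose * (∑ a, v a • S a) * U := by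
    intro v
    simp [hS', Finset.mul_sum, Finset.sum_mul]
  have hT : ∑ i, d i ^ 2 = frobInner X X := by
    rw [← frobInner_self_conj hU X, hd, frobInner_self_eq_sum]
    refine Finset.sum_congr rfl fun i _ => ?_
    rw [Finset.sum_eq_single i (fun j _ hj => by simp [Matrix.diagonal_apply_ne _ hj.symm])
      (by simp), Matrix.diagonal_apply_eq]
  have hlie : ∀ a, ⁅Matrix.diagonal d, S' a⁆ = U.transpose * ⁅X, S a⁆ * U := by
    intro a
    have key : ∀ P Q : Matrix n n ℝ, (U.transpose * P * U) * (U.transpose * Q * U)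
        = U.transpose * (P * Q) * U := by
      intro P Q
      calc (U.transpose * P * U) * (U.transpose * Q * U)
          = U.transpose * P * (U * U.transpose) * Q * U := by simp only [mul_assoc]
        _ = U.transpose * (P * Q) * U := by rw [hU, mul_one]; simp only [mul_assoc]
    rw [← hd, Ring.lie_def, Ring.lie_def, key, key, mul_sub, sub_mul]
  have := sum_frobInner_lie_diagonal_le S'
    (fun a => by
      simp only [hS', Matrix.IsSymm, Matrix.transpose_mul, Matrix.transpose_transpose,
        (hS a).eq, mul_assoc])
    c hc d (by rw [hcomb, ← hX, hd])
    (fun v => by rw [hcomb, frobInner_self_conj hU, hT]; exact hmax v)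
  have hnorm : ∀ a, frobInner (S' a) (S' a) = frobInner (S a) (S a) :=
    fun a => frobInner_self_conj hU (S a)
  simpa only [hT, hlie, hnorm, frobInner_self_conj hU] using this

/-! ### Extremal families of symmetric matrices -/

/-- A continuous function homogeneous of positive even degree attains its maximum over the unit
sphere of a nonzero subspace. -/
theorem exists_unit_maximizer {κ : Type*} [Fintype κ] (f : (κ → ℝ) → ℝ) (hf : Continuous f)
    (p : ℕ) (hp : p ≠ 0) (hom : ∀ (s : ℝ) (x : κ → ℝ), f (s • x) = s ^ (2 * p) * f x)
    (W : Submodule ℝ (κ → ℝ)) (hW : W ≠ ⊥) :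
    ∃ x ∈ W, ∑ k, x k ^ 2 = 1 ∧ ∀ y ∈ W, f y ≤ f x * (∑ k, y k ^ 2) ^ p := by
  have hnn : ∀ y : κ → ℝ, 0 ≤ ∑ k, y k ^ 2 := fun y => Finset.sum_nonneg fun k _ => sq_nonneg _
  have hpos : ∀ y : κ → ℝ, y ≠ 0 → 0 < ∑ k, y k ^ 2 := by
    intro y hy
    refine (hnn y).lt_of_ne' fun h => hy ?_
    rw [Finset.sum_eq_zero_iff_of_nonneg fun k _ => sq_nonneg _] at h
    funext k
    simpa using h k (Finset.mem_univ k)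
  have hsmul : ∀ (s : ℝ) (y : κ → ℝ), ∑ k, (s • y) k ^ 2 = s ^ 2 * ∑ k, y k ^ 2 := by
    intro s y
    simp [mul_pow, Finset.mul_sum]
  have hnorm : ∀ y ∈ W, y ≠ 0 → (√(∑ k, y k ^ 2))⁻¹ • y ∈ W ∧
      ∑ k, ((√(∑ k, y k ^ 2))⁻¹ • y) k ^ 2 = 1 := by
    intro y hy h0
    refine ⟨W.smul_mem _ hy, ?_⟩
    rw [hsmul, inv_pow, Real.sq_sqrt (hnn y), inv_mul_cancel₀ (hpos y h0).ne']
  set K : Set (κ → ℝ) := {x | x ∈ W ∧ ∑ k, x k ^ 2 = 1} with hK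
  have hcl : IsClosed K := W.closed_of_finiteDimensional.inter
    (isClosed_eq (by fun_prop) continuous_const)
  have hcomp : IsCompact K := by
    refine (isCompact_Icc (a := fun _ : κ => (-1 : ℝ)) (b := fun _ => 1)).of_isClosed_subset hcl ?_
    rintro x ⟨-, hx⟩
    have : ∀ k, x k ^ 2 ≤ 1 := fun k => hx ▸
      Finset.single_le_sum (f := fun k => x k ^ 2) (fun k _ => sq_nonneg _) (Finset.mem_univ k)
    exact ⟨fun k => (abs_le.1 ((sq_le_one_iff_abs_le_one _).1 (this k))).1,
      fun k => (abs_le.1 ((sq_le_one_iff_abs_le_one _).1 (this k))).2⟩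
  obtain ⟨y₀, hy₀, hy₀0⟩ := W.ne_bot_iff.1 hW
  obtain ⟨x, ⟨hxW, hx1⟩, hmax⟩ :=
    hcomp.exists_isMaxOn ⟨_, hnorm y₀ hy₀ hy₀0⟩ hf.continuousOn
  refine ⟨x, hxW, hx1, fun y hy => ?_⟩
  by_cases h0 : y = 0
  · have := hom 0 y
    simp only [zero_smul, h0, zero_pow (mul_ne_zero two_ne_zero hp), zero_mul] at this
    simp [h0, this, hp]
  · have h1 := hmax (hnorm y hy h0)
    have hs : 0 < √(∑ k, y k ^ 2) := Real.sqrt_pos.2 (hpos y h0)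
    have h2 : f y = (∑ k, y k ^ 2) ^ p * f ((√(∑ k, y k ^ 2))⁻¹ • y) := by
      rw [hom, inv_pow, pow_mul, Real.sq_sqrt (hnn y),
        mul_inv_cancel_left₀ (pow_ne_zero _ (hpos y h0).ne')]
    rw [h2, mul_comm]
    exact mul_le_mul_of_nonneg_right h1 (pow_nonneg (hnn y) _)

/-- First variation of the quartic `∑ a b, ‖[S a, S b]‖²` against `(∑ a, ‖S a‖²)²` at a family `S`
where their ratio attains its maximum `M`, in the direction `a ↦ c a • X` with
`X = ∑ a, c a • S a`. -/
theorem mul_frobInner_le_of_maximizer {n ι : Type*} [Fintype n] [DecidableEq n] [Fintype ι]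
    (S : ι → Matrix n n ℝ) (hS1 : ∑ a, frobInner (S a) (S a) = 1)
    (M : ℝ) (hM : ∑ a, ∑ b, frobInner ⁅S a, S b⁆ ⁅S a, S b⁆ = M)
    (c : ι → ℝ) (hc : ∑ a, c a ^ 2 = 1) (X : Matrix n n ℝ) (hX : X = ∑ a, c a • S a)
    (hmax : ∀ s : ℝ, ∑ a, ∑ b, frobInner ⁅S a + (s * c a) • X, S b + (s * c b) • X⁆
        ⁅S a + (s * c a) • X, S b + (s * c b) • X⁆
      ≤ M * (∑ a, frobInner (S a + (s * c a) • X) (S a + (s * c a) • X)) ^ 2) :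
    M * frobInner X X ≤ ∑ a, frobInner ⁅X, S a⁆ ⁅X, S a⁆ := by
  set t := frobInner X X with ht
  set K := ∑ a, frobInner ⁅X, S a⁆ ⁅X, S a⁆ with hK
  have ht0 : 0 ≤ t := frobInner_self_nonneg X
  have hM0 : 0 ≤ M := hM ▸ Finset.sum_nonneg fun a _ => Finset.sum_nonneg fun b _ =>
    frobInner_self_nonneg _
  have hN : ∀ s : ℝ, ∑ a, frobInner (S a + (s * c a) • X) (S a + (s * c a) • X)
      = 1 + (2 * s + s ^ 2) * t := by
    intro s
    have hcross : ∑ a, c a * frobInner (S a) X = t :=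
      calc ∑ a, c a * frobInner (S a) X = ∑ a, frobInner (c a • S a) X := by simp
        _ = t := by rw [← LinearMap.sum_apply, ← map_sum, ← hX]
    have : ∀ a, frobInner (S a + (s * c a) • X) (S a + (s * c a) • X)
        = frobInner (S a) (S a) + 2 * s * (c a * frobInner (S a) X) + s ^ 2 * t * c a ^ 2 := by
      intro a
      simp only [map_add, map_smul, LinearMap.add_apply, LinearMap.smul_apply, smul_eq_mul,
        frobInner_comm X (S a), ← ht]
      ring
    simp only [this, Finset.sum_add_distrib, ← Finset.mul_sum, hS1, hcross, hc]
    ring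
  -- The terms quadratic in `s` only help, so they are dropped.
  have hQ : ∀ s : ℝ, M + 4 * s * K ≤
      ∑ a, ∑ b, frobInner ⁅S a + (s * c a) • X, S b + (s * c b) • X⁆
        ⁅S a + (s * c a) • X, S b + (s * c b) • X⁆ := by
    intro s
    set D : ι → ι → Matrix n n ℝ := fun a b => c a • ⁅X, S b⁆ - c b • ⁅X, S a⁆ with hD
    have hlie : ∀ a b, ⁅S a + (s * c a) • X, S b + (s * c b) • X⁆ = ⁅S a, S b⁆ + s • D a b := by
      intro a b
      simp only [hD, Ring.lie_def, add_mul, mul_add, smul_mul_assoc, mul_smul_comm, smul_sub,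
        smul_smul]
      module
    have hA : ∑ a, ∑ b, c a * frobInner ⁅S a, S b⁆ ⁅X, S b⁆ = K := by
      rw [Finset.sum_comm, hK]
      refine Finset.sum_congr rfl fun b _ => ?_
      have hXb : ⁅X, S b⁆ = ∑ a, c a • ⁅S a, S b⁆ := by
        simp only [hX, Ring.lie_def, Finset.sum_mul, Finset.mul_sum, smul_mul_assoc,
          mul_smul_comm, smul_sub, Finset.sum_sub_distrib]
      calc ∑ a, c a * frobInner ⁅S a, S b⁆ ⁅X, S b⁆
          = ∑ a, frobInner (c a • ⁅S a, S b⁆) ⁅X, S b⁆ := by simp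
        _ = frobInner ⁅X, S b⁆ ⁅X, S b⁆ := by rw [← LinearMap.sum_apply, ← map_sum, ← hXb]
    have hB : ∑ a, ∑ b, c b * frobInner ⁅S a, S b⁆ ⁅X, S a⁆ = -K := by
      rw [Finset.sum_comm, ← hA, ← Finset.sum_neg_distrib]
      refine Finset.sum_congr rfl fun a _ => ?_
      rw [← Finset.sum_neg_distrib]
      refine Finset.sum_congr rfl fun b _ => ?_
      have : ⁅S b, S a⁆ = -⁅S a, S b⁆ := by simp only [Ring.lie_def, neg_sub]
      rw [this, map_neg, LinearMap.neg_apply]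
      ring
    have hpt : ∀ a b, frobInner ⁅S a, S b⁆ ⁅S a, S b⁆
        + 2 * s * (c a * frobInner ⁅S a, S b⁆ ⁅X, S b⁆ - c b * frobInner ⁅S a, S b⁆ ⁅X, S a⁆)
        ≤ frobInner (⁅S a, S b⁆ + s • D a b) (⁅S a, S b⁆ + s • D a b) := by
      intro a b
      have hDD := mul_nonneg (sq_nonneg s) (frobInner_self_nonneg (D a b))
      have hDc : frobInner ⁅S a, S b⁆ (D a b)
          = c a * frobInner ⁅S a, S b⁆ ⁅X, S b⁆ - c b * frobInner ⁅S a, S b⁆ ⁅X, S a⁆ := by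
        simp only [hD, map_sub, map_smul, smul_eq_mul]
      simp only [map_add, map_smul, LinearMap.add_apply, LinearMap.smul_apply, smul_eq_mul,
        frobInner_comm (D a b) ⁅S a, S b⁆, hDc]
      linarith
    simp only [hlie]
    refine le_trans (le_of_eq ?_) (Finset.sum_le_sum fun a _ => Finset.sum_le_sum fun b _ =>
      hpt a b)
    simp only [Finset.sum_add_distrib, ← Finset.mul_sum _ _ (2 * s), Finset.sum_sub_distrib,
      hM, hA, hB]
    ring
  -- Dividing the inequality at `s = -ε` by `4 ε` and letting `ε` tend to `0` gives the claim.
  have hε : ∀ ε : ℝ, 0 < ε → ε < 1 → M * t ≤ K + ε * (M * (t + t ^ 2)) := by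
    intro ε hε0 hε1
    have h := (hQ (-ε)).trans (hmax (-ε))
    rw [hN] at h
    have hMt2 : 0 ≤ M * t ^ 2 := mul_nonneg hM0 (sq_nonneg t)
    have hMt : 0 ≤ M * t := mul_nonneg hM0 ht0
    have h5 : 4 * ε * (M * t) ≤ 4 * ε * (K + ε * (M * (t + t ^ 2))) := by
      have e1 : (2 - ε) ^ 2 ≤ 4 := by nlinarith
      have e2 := mul_le_mul_of_nonneg_left e1 (mul_nonneg (sq_nonneg ε) hMt2)
      have e3 := mul_nonneg (sq_nonneg ε) hMt
      linarith
    exact le_of_mul_le_mul_left h5 (by linarith)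
  have hlim : Filter.Tendsto (fun ε : ℝ => K + ε * (M * (t + t ^ 2))) (nhdsWithin 0 (Set.Ioi 0))
      (nhds K) := by
    have : Continuous fun ε : ℝ => K + ε * (M * (t + t ^ 2)) := by fun_prop
    simpa using (this.tendsto 0).mono_left nhdsWithin_le_nhds
  refine ge_of_tendsto hlim ?_
  filter_upwards [Ioo_mem_nhdsGT (zero_lt_one' ℝ)] with ε h
  exact hε ε h.1 h.2

/-! ### The commutator inequality -/

/-- The DDVV inequality for a finite family of real symmetric matrices. -/
theorem sum_sum_frobInner_lie_le {n ι : Type*} [Fintype n] [DecidableEq n] [Fintype ι]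
    (S : ι → Matrix n n ℝ) (hS : ∀ a, (S a).IsSymm) :
    ∑ a, ∑ b, frobInner ⁅S a, S b⁆ ⁅S a, S b⁆ ≤ (∑ a, frobInner (S a) (S a)) ^ 2 := by
  classical
  -- Families of matrices are encoded as vectors indexed by `ι × n × n`.
  let F : (ι × n × n → ℝ) → ι → Matrix n n ℝ := fun x a => Matrix.of fun i j => x (a, i, j)
  let Q : (ι × n × n → ℝ) → ℝ := fun x => ∑ a, ∑ b, frobInner ⁅F x a, F x b⁆ ⁅F x a, F x b⁆
  let W : Submodule ℝ (ι × n × n → ℝ) :=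
    { carrier := {x | ∀ a i j, x (a, i, j) = x (a, j, i)}
      add_mem' := fun {x y} hx hy a i j => by simp only [Pi.add_apply, hx a i j, hy a i j]
      zero_mem' := fun _ _ _ => rfl
      smul_mem' := fun s x hx a i j => by simp only [Pi.smul_apply, hx a i j] }
  let G : (ι → Matrix n n ℝ) → ι × n × n → ℝ := fun S k => S k.1 k.2.1 k.2.2
  have hGW : ∀ S : ι → Matrix n n ℝ, (∀ a, (S a).IsSymm) → G S ∈ W :=
    fun S hS a i j => (hS a).apply j i
  have hnormsq : ∀ x : ι × n × n → ℝ, ∑ k, x k ^ 2 = ∑ a, frobInner (F x a) (F x a) := by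
    intro x
    simp only [frobInner_self_eq_sum, Fintype.sum_prod_type, F, Matrix.of_apply]
  have hQc : Continuous Q := by
    simp only [Q, F, frobInner_self_eq_sum, Ring.lie_def, Matrix.sub_apply, Matrix.mul_apply,
      Matrix.of_apply]
    fun_prop
  have hQhom : ∀ (s : ℝ) x, Q (s • x) = s ^ (2 * 2) * Q x := by
    intro s x
    have hF : ∀ a, F (s • x) a = s • F x a := fun a => rfl
    simp only [Q, hF, Ring.lie_def, smul_mul_smul_comm, ← smul_sub, map_smul,
      LinearMap.smul_apply, smul_eq_mul, Finset.mul_sum]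
    refine Finset.sum_congr rfl fun a _ => Finset.sum_congr rfl fun b _ => ?_
    ring
  by_cases hW : W = ⊥
  · have hz : ∀ a, S a = 0 := by
      intro a
      ext i j
      have : G S ∈ W := hGW S hS
      rw [hW, Submodule.mem_bot] at this
      exact congrFun this (a, i, j)
    simp [hz, Ring.lie_def]
  obtain ⟨x, hxW, hx1, hxmax⟩ := exists_unit_maximizer Q hQc 2 two_ne_zero hQhom W hW
  have hFsymm : ∀ a, (F x a).IsSymm := fun a => Matrix.IsSymm.ext fun i j => hxW a j i
  have hF1 : ∑ a, frobInner (F x a) (F x a) = 1 := by rw [← hnormsq, hx1]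
  have hmaxS : ∀ S : ι → Matrix n n ℝ, (∀ a, (S a).IsSymm) →
      ∑ a, ∑ b, frobInner ⁅S a, S b⁆ ⁅S a, S b⁆
        ≤ Q x * (∑ a, frobInner (S a) (S a)) ^ 2 := by
    intro S hS
    have := hxmax (G S) (hGW S hS)
    rwa [hnormsq] at this
  -- The unit coefficient vector whose combination of the maximizing family has largest norm.
  have hι : (⊤ : Submodule ℝ (ι → ℝ)) ≠ ⊥ := by
    have : Nonempty ι := by
      by_contra h
      rw [not_nonempty_iff] at h
      simp at hF1
    exact top_ne_bot
  obtain ⟨c, -, hc1, hcmax⟩ := exists_unit_maximizer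
    (fun v : ι → ℝ => frobInner (∑ a, v a • F x a) (∑ a, v a • F x a))
    (by
      simp only [frobInner_self_eq_sum, Matrix.sum_apply, Matrix.smul_apply]
      fun_prop) 1 one_ne_zero
    (by
      intro s v
      have : ∑ a, (s • v) a • F x a = s • ∑ a, v a • F x a := by
        simp [Finset.smul_sum, smul_smul]
      simp only [this, map_smul, LinearMap.smul_apply, smul_eq_mul]
      ring) ⊤ hι
  set X := ∑ a, c a • F x a with hX
  have hXs : X.IsSymm := by
    rw [hX, Matrix.IsSymm, Matrix.transpose_sum]
    exact Finset.sum_congr rfl fun a _ => by rw [Matrix.transpose_smul, (hFsymm a).eq]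
  have hcmax' : ∀ v : ι → ℝ, frobInner (∑ a, v a • F x a) (∑ a, v a • F x a)
      ≤ frobInner X X * ∑ a, v a ^ 2 := fun v => by
    simpa only [pow_one] using hcmax v Submodule.mem_top
  have hupper := sum_frobInner_lie_le (F x) hFsymm c hc1 X hX hcmax'
  have hlower := mul_frobInner_le_of_maximizer (F x) hF1 (Q x) rfl c hc1 X hX
    (fun s => hmaxS _ fun a => (hFsymm a).add (hXs.smul _))
  rw [hF1, mul_one] at hupper
  have hXpos : 0 < frobInner X X := by
    refine (frobInner_self_nonneg X).lt_of_ne' fun h0 => ?_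
    have hz : ∀ a, frobInner (F x a) (F x a) = 0 := by
      intro a
      refine le_antisymm ?_ (frobInner_self_nonneg _)
      simpa [h0, Pi.single_apply] using hcmax' (Pi.single a 1)
    simp [hz] at hF1
  have hQ1 : Q x ≤ 1 := le_of_mul_le_mul_right (by linarith) hXpos
  exact (hmaxS S hS).trans (mul_le_of_le_one_left (sq_nonneg _) hQ1)

theorem mainTheorem3 (n : ℕ) (A B C : Matrix (Fin n) (Fin n) ℝ)
    (hA : A.IsSymm) (hB : B.IsSymm) (hC : C.IsSymm)
    (hA0 : A.trace = 0) (hB0 : B.trace = 0) (hC0 : C.trace = 0) :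
    (‖A‖ ^ 2 + ‖B‖ ^ 2 + ‖C‖ ^ 2) ^ 2 ≥
      2 * ‖⁅A, B⁆‖ ^ 2 + 2 * ‖⁅B, C⁆‖ ^ 2 + 2 * ‖⁅C, A⁆‖ ^ 2 := by
  have h := sum_sum_frobInner_lie_le ![A, B, C] (by
    intro a
    fin_cases a
    exacts [hA, hB, hC])
  have hcomm : ∀ P R : Matrix (Fin n) (Fin n) ℝ,
      frobInner ⁅P, R⁆ ⁅P, R⁆ = frobInner ⁅R, P⁆ ⁅R, P⁆ := by
    intro P R
    have : ⁅P, R⁆ = -⁅R, P⁆ := by simp only [Ring.lie_def, neg_sub]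
    simp only [this, map_neg, LinearMap.neg_apply, neg_neg]
  have hself : ∀ P : Matrix (Fin n) (Fin n) ℝ, ⁅P, P⁆ = 0 := fun P => by
    rw [Ring.lie_def, sub_self]
  simp only [Fin.sum_univ_three, Matrix.cons_val_zero, Matrix.cons_val_one, Matrix.cons_val,
    hself, map_zero, hcomm B A, hcomm C B, hcomm A C] at h
  simp only [frobenius_norm_sq_eq, ← frobInner_self_eq_sum]
  linarith
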